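/- Let $k\ge 3$ be an integer, let $\alpha\ge 5$ be a rational number, and let $\Sigma_k$ be an alphabet with $k$ letters. For a nonempty finite word $r$ and a positive rational $\beta$, a $\beta$-power $r^{\beta}$ is a word of the form $rr\cdots rt$ with $t$ a prefix of $r$ and $|r^{\beta}|/|r|=\beta$. A finite word is $\alpha$-power free if it has no factor of the form $r^{\beta}$ with $r$ nonempty and $\beta\ge\alpha$; a left infinite, right infinite or bi-infinite word is $\alpha$-power free if all its finite factors are. A nonempty finite word is recurrent in an infinite word if it occurs in it infinitely many times. A nonempty factor $u$ of a bi-infinite $\alpha$-power free word $v$ is on-right-side recurrent in $v$ if $v=v_1v_2$ for some left infinite $\alpha$-power free word $v_1$ and some right infinite $\alpha$-power free word $v_2$ such that $u$ is recurrent in $v_2$. Let $v$ be a bi-infinite $\alpha$-power free word over $\Sigma_k$, let $w$ be a nonempty finite factor of $v$, and let $x\in\Sigma_k$ be a letter that occurs in $w$ and is on-right-side recurrent in $v$. Then there is a bi-infinite $\alpha$-power free word $\widehat v$ over $\Sigma_k$ such that $w$ is a factor of $\widehat v$ and $x$ is not recurrent in $\widehat v$, that is, $x$ occurs only finitely many times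 in $\widehat v$. -/

import Mathlib

namespace PowerFreeWords

/-- `IsPower r β u` says that `u` is the `β`-power of the nonempty word `r`: `β` is a positive
rational, `u = r r ⋯ r t` with `t` a prefix of `r`, and `|u| / |r| = β`. -/
def IsPower {A : Type*} (r : List A) (β : ℚ) (u : List A) : Prop :=
  r ≠ [] ∧ 0 < β ∧
    (∃ (n : ℕ) (t : List A), t <+: r ∧ u = (List.replicate n r).flatten ++ t) ∧
    (u.length : ℚ) / (r.length : ℚ) = β

/-- A finite word is `α`-power free if it has no factor `r ^ β` with `r` nonempty and `β ≥ α`. -/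
def PowerFree {A : Type*} (α : ℚ) (w : List A) : Prop :=
  ∀ (r : List A) (β : ℚ) (u : List A), IsPower r β u → u <:+: w → ¬ α ≤ β

/-- Right infinite words `t = t 0, t 1, t 2, ⋯`. -/
abbrev RightWord (A : Type*) := ℕ → A

/-- Left infinite words `s = ⋯, s 2, s 1, s 0`, indexed from right to left. -/
abbrev LeftWord (A : Type*) := ℕ → A

/-- Bi-infinite words `v = ⋯, v (-1), v 0, v 1, ⋯`. The choice of the origin is immaterial:
all the notions below are invariant under shifts. -/
abbrev BiWord (A : Type*) := ℤ → A

/-- The finite word `u` occurs in the right infinite word `t` at position `i`. -/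
def RightWord.OccursAt {A : Type*} (t : RightWord A) (u : List A) (i : ℕ) : Prop :=
  u = (List.range u.length).map fun j : ℕ => t (i + j)

/-- The finite word `u` occurs in the left infinite word `s`, with its last letter at position `i`
(recall that positions are counted from right to left). -/
def LeftWord.OccursAt {A : Type*} (s : LeftWord A) (u : List A) (i : ℕ) : Prop :=
  u = ((List.range u.length).map fun j : ℕ => s (i + j)).reverse

/-- The finite word `u` occurs in the bi-infinite word `v` at position `i`. -/
def BiWord.OccursAt {A : Type*} (v : BiWord A) (u : List A) (i : ℤ) : Prop :=
  u = (List.range u.length).map fun j : ℕ => v (i + (j : ℤ))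

/-- `u` is a finite factor of the right infinite word `t`. -/
def RightWord.IsFactor {A : Type*} (t : RightWord A) (u : List A) : Prop :=
  ∃ i, RightWord.OccursAt t u i

/-- `u` is a finite factor of the left infinite word `s`. -/
def LeftWord.IsFactor {A : Type*} (s : LeftWord A) (u : List A) : Prop :=
  ∃ i, LeftWord.OccursAt s u i

/-- `u` is a finite factor of the bi-infinite word `v`. -/
def BiWord.IsFactor {A : Type*} (v : BiWord A) (u : List A) : Prop :=
  ∃ i, BiWord.OccursAt v u i

/-- A right infinite word is `α`-power free if all its finite factors are. -/
def RightWord.PowerFree {A : Type*} (α : ℚ) (t : RightWord A) : Prop :=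
  ∀ u, RightWord.IsFactor t u → PowerFreeWords.PowerFree α u

/-- A left infinite word is `α`-power free if all its finite factors are. -/
def LeftWord.PowerFree {A : Type*} (α : ℚ) (s : LeftWord A) : Prop :=
  ∀ u, LeftWord.IsFactor s u → PowerFreeWords.PowerFree α u

/-- A bi-infinite word is `α`-power free if all its finite factors are. -/
def BiWord.PowerFree {A : Type*} (α : ℚ) (v : BiWord A) : Prop :=
  ∀ u, BiWord.IsFactor v u → PowerFreeWords.PowerFree α u

/-- The nonempty word `u` is recurrent in the right infinite word `t`: it has infinitely many
occurrences. -/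
def RightWord.IsRecurrent {A : Type*} (t : RightWord A) (u : List A) : Prop :=
  u ≠ [] ∧ {i | RightWord.OccursAt t u i}.Infinite

/-- The nonempty word `u` is recurrent in the bi-infinite word `v`: it has infinitely many
occurrences (on whichever side). -/
def BiWord.IsRecurrent {A : Type*} (v : BiWord A) (u : List A) : Prop :=
  u ≠ [] ∧ {i | BiWord.OccursAt v u i}.Infinite

/-- The bi-infinite word `v` is the concatenation `s t` of the left infinite word `s` and the right
infinite word `t`; here `c` is the position in `v` of the first letter of `t`. -/
def BiWord.IsConcat {A : Type*} (v : BiWord A) (s : LeftWord A) (t : RightWord A) : Prop :=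
  ∃ c : ℤ, (∀ n : ℕ, v (c + (n : ℤ)) = t n) ∧ (∀ n : ℕ, v (c - 1 - (n : ℤ)) = s n)

/-- `u` is on-right-side recurrent in `v`: one can write `v = v₁ v₂` with `v₁` a left infinite and
`v₂` a right infinite `α`-power free word such that `u` is recurrent in `v₂`. -/
def BiWord.IsOnRightSideRecurrent {A : Type*} (α : ℚ) (v : BiWord A) (u : List A) : Prop :=
  ∃ (v₁ : LeftWord A) (v₂ : RightWord A), LeftWord.PowerFree α v₁ ∧ RightWord.PowerFree α v₂ ∧
    BiWord.IsConcat v v₁ v₂ ∧ RightWord.IsRecurrent v₂ u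

end PowerFreeWords

/-! Past an occurrence `n` of `x`, replace the tail of `v` by a Thue–Morse word `t` on two letters
other than `x`. A forbidden run of period `l` in the new word must start at or before `n` and
outlast the common prefix of `t` and the old tail. As `t` avoids `x`, the run ends less than `l`
beyond `n`, so it contains `n - l`: another `x`, followed by a longer match with `t`. If `n` is a
record for the match length, this forces `n - l < M` for a fixed `M`.

If `x` is absent far to the left, the `x` that periodicity puts at `n - 2 * l` is a contradiction
(`RunFree.extendRight`). Otherwise cut on both sides, at `n` and `-q`. A forbidden run cannot
outlast both matches, by a length count; if it outlasts one, it exposes a long run of `v` itself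
(`exists_obstruction`). `exists_unobstructed` picks `n` and `q` so that no such run exists. -/

namespace PowerFreeWords

/-! ### Powers as periodic runs -/

/-- The word `u` has period `l` on the interval `[a, b)`. -/
def PeriodicOn {A : Type*} (u : ℤ → A) (a b l : ℤ) : Prop :=
  ∀ s, a ≤ s → s + l < b → u s = u (s + l)

/-- No factor of `u` of period `l` has length at least `α * l`. -/
def RunFree {A : Type*} (α : ℚ) (u : ℤ → A) : Prop :=
  ∀ a b l : ℤ, 0 < l → α * l ≤ ((b - a : ℤ) : ℚ) → ¬ PeriodicOn u a b l

/-- The prefix relation encodes the period `r.length`; copies of `r` are peeled off one at a time.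
-/
lemma exists_power_of_prefix_append {A : Type*} {r : List A} (hr : r ≠ []) :
    ∀ (N : ℕ) (u : List A), u.length ≤ N → u <+: r ++ u →
      ∃ (n : ℕ) (t : List A), t <+: r ∧ u = (List.replicate n r).flatten ++ t := by
  intro N
  induction N with
  | zero =>
    intro u hu _
    have : u = [] := List.length_eq_zero_iff.mp (by omega)
    exact ⟨0, [], List.nil_prefix, by simp [this]⟩
  | succ N ih =>
    intro u hu h
    by_cases hl : u.length ≤ r.length
    · exact ⟨0, u, List.prefix_of_prefix_length_le h (List.prefix_append r u) hl, by simp⟩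
    · obtain ⟨u', rfl⟩ := List.prefix_of_prefix_length_le (List.prefix_append r u) h (by omega)
      have hr' := List.length_pos_iff.mpr hr
      obtain ⟨n, t, ht, e⟩ := ih u' (by rw [List.length_append] at hu; omega)
        ((List.prefix_append_right_inj r).mp h)
      exact ⟨n + 1, t, ht, by rw [List.replicate_succ, List.flatten_cons, List.append_assoc, ← e]⟩

lemma prefix_append_of_power {A : Type*} {r t : List A} (ht : t <+: r) (n : ℕ) :
    (List.replicate n r).flatten ++ t <+: r ++ ((List.replicate n r).flatten ++ t) := by
  induction n with
  | zero => simpa using ht.trans (List.prefix_append r t)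
  | succ n ih =>
    rw [List.replicate_succ, List.flatten_cons, List.append_assoc]
    exact (List.prefix_append_right_inj r).mpr ih

lemma BiWord.PowerFree.runFree {A : Type*} {α : ℚ} (hα : 0 < α) {v : BiWord A}
    (hv : BiWord.PowerFree α v) : RunFree α v := by
  intro a b l hl hab hper
  have hl' : (0 : ℚ) < l := by exact_mod_cast hl
  have hba : 0 < b - a := by
    have : (0 : ℚ) < ((b - a : ℤ) : ℚ) := lt_of_lt_of_le (mul_pos hα hl') hab
    exact_mod_cast this
  obtain ⟨N, hN⟩ := Int.eq_ofNat_of_zero_le hba.le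
  obtain ⟨m, rfl⟩ := Int.eq_ofNat_of_zero_le hl.le
  set u : List A := (List.range N).map fun j : ℕ => v (a + (j : ℤ)) with hu
  set r : List A := (List.range m).map fun j : ℕ => v (a + (j : ℤ)) with hr
  have hr0 : r ≠ [] := by
    intro h
    have := congrArg List.length h
    simp [hr] at this
    omega
  have hpre : u <+: r ++ u := by
    rw [List.prefix_iff_getElem]
    refine ⟨by simp, fun i hi => ?_⟩
    have hi' : i < N := by simpa [hu] using hi
    rw [List.getElem_append]
    split_ifs with h
    · simp [hu, hr]
    · have h' : m ≤ i := by simpa [hr] using h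
      simp only [hu, hr, List.getElem_map, List.getElem_range, List.length_map, List.length_range]
      have := hper (a + ((i - m : ℕ) : ℤ)) (by omega) (by push_cast [h']; omega)
      rw [this]
      congr 1
      push_cast [h']
      ring
  obtain ⟨n, t, ht, e⟩ := exists_power_of_prefix_append hr0 _ u le_rfl hpre
  have hul : u.length = N := by simp [hu]
  have hrl : r.length = m := by simp [hr]
  have hN0 : 0 < N := by omega
  have hm0 : 0 < m := by omega
  refine hv u ⟨a, ?_⟩ r ((N : ℚ) / m) u ⟨hr0, by positivity, ⟨n, t, ht, e⟩, ?_⟩ (List.infix_refl u) ?_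
  · rw [BiWord.OccursAt, hul]
  · rw [hul, hrl]
  · rw [le_div_iff₀ (by exact_mod_cast hm0)]
    rw [hN] at hab
    exact_mod_cast hab

lemma RunFree.biWord_powerFree {A : Type*} {α : ℚ} {v : BiWord A}
    (hv : RunFree α v) : BiWord.PowerFree α v := by
  rintro u ⟨i, hi⟩ r β p ⟨hr0, hβ, ⟨n, t, ht, e⟩, hlen⟩ ⟨y, z, hyz⟩ hαβ
  have hpre : p <+: r ++ p := by
    rw [e]
    exact prefix_append_of_power ht n
  have hr := List.length_pos_iff.mpr hr0
  have hget : ∀ (j : ℕ) (hj : j < p.length), p[j] = v (i + y.length + j) := by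
    intro j hj
    have h1 : u[y.length + j]? = some p[j] := by
      rw [← hyz, List.append_assoc, List.getElem?_append_right (by omega),
        List.getElem?_append_left (by omega)]
      simp [hj]
    have hjl : y.length + j < u.length := by
      rw [← hyz]; simp; omega
    rw [hi, List.getElem?_map, List.getElem?_range hjl] at h1
    simp only [Option.map_some, Option.some.injEq] at h1
    rw [← h1]
    push_cast
    ring_nf
  refine hv (i + y.length) (i + y.length + p.length) r.length (by omega) ?_ ?_
  · rw [← hlen, le_div_iff₀ (by exact_mod_cast hr)] at hαβ
    push_cast
    linarith
  · intro s hs hs'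
    obtain ⟨j, hj⟩ := Int.eq_ofNat_of_zero_le (sub_nonneg.mpr hs)
    obtain rfl : s = i + y.length + j := by omega
    have hjp : j + r.length < p.length := by omega
    have h := (List.prefix_iff_getElem.mp hpre).2 (j + r.length) hjp
    rw [List.getElem_append_right (by omega), hget _ hjp] at h
    simp only [Nat.add_sub_cancel] at h
    rw [hget j (by omega)] at h
    rw [← h]
    push_cast
    ring_nf

/-! ### Thue–Morse and avoidance of fifth powers -/

/-- The Thue–Morse word. -/
def thueMorse (n : ℕ) : Bool := (Nat.digits 2 n).sum.bodd

lemma thueMorse_two_mul (n : ℕ) : thueMorse (2 * n) = thueMorse n := by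
  rcases Nat.eq_zero_or_pos n with rfl | h
  · rfl
  · rw [thueMorse, Nat.digits_def' (by norm_num) (by omega)]
    simp [thueMorse]

lemma thueMorse_two_mul_add_one (n : ℕ) : thueMorse (2 * n + 1) = !thueMorse n := by
  rw [thueMorse, Nat.digits_def' (by norm_num) (by omega)]
  have h1 : (2 * n + 1) % 2 = 1 := by omega
  have h2 : (2 * n + 1) / 2 = n := by omega
  simp [thueMorse, h1, h2]

/-- An even period descends to its half. For an odd one, the values at `4k+1` and `4k+2` agree,
while their translates form a pair `2j`, `2j+1` and differ. -/
lemma exists_thueMorse_ne (l : ℕ) :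
    0 < l → ∀ a, ∃ s, a ≤ s ∧ s < a + 4 * l ∧ thueMorse s ≠ thueMorse (s + l) := by
  induction l using Nat.strong_induction_on with
  | _ l ih =>
    intro hl a
    obtain ⟨m, rfl | rfl⟩ := Nat.even_or_odd' l
    · obtain ⟨s, h1, h2, h3⟩ := ih m (by omega) (by omega) ((a + 1) / 2)
      refine ⟨2 * s, by omega, by omega, ?_⟩
      rwa [← mul_add, thueMorse_two_mul, thueMorse_two_mul]
    · by_contra! h
      have key : ∀ k, a ≤ 4 * k + 1 → 4 * k + 2 < a + 4 * (2 * m + 1) → False := by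
        intro k hk hk'
        have e1 := h (4 * k + 1) hk (by omega)
        have e2 := h (4 * k + 2) (by omega) hk'
        rw [show 4 * k + 1 = 2 * (2 * k) + 1 by ring,
          show 2 * (2 * k) + 1 + (2 * m + 1) = 2 * (2 * k + m + 1) by ring] at e1
        rw [show 4 * k + 2 = 2 * (2 * k + 1) by ring,
          show 2 * (2 * k + 1) + (2 * m + 1) = 2 * (2 * k + m + 1) + 1 by ring] at e2
        simp only [thueMorse_two_mul, thueMorse_two_mul_add_one] at e1 e2
        rw [← e1] at e2
        revert e2
        cases thueMorse k <;> simp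
      -- For `l = 1` the window of four positions may miss every pair `4k+1`, `4k+2`, but it
      -- contains a pair `2j`, `2j+1`.
      rcases Nat.eq_zero_or_pos m with rfl | hm
      · have e := h (2 * ((a + 1) / 2)) (by omega) (by omega)
        rw [show 2 * ((a + 1) / 2) + (2 * 0 + 1) = 2 * ((a + 1) / 2) + 1 by ring,
          thueMorse_two_mul, thueMorse_two_mul_add_one] at e
        revert e
        cases thueMorse ((a + 1) / 2) <;> simp
      · exact key ((a + 2) / 4) (by omega) (by omega)

lemma exists_word_avoiding {A : Type*} [Fintype A] (hA : 3 ≤ Fintype.card A) (x : A) :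
    ∃ t : ℕ → A, (∀ i, t i ≠ x) ∧
      ∀ l, 0 < l → ∀ a, ∃ s, a ≤ s ∧ s < a + 4 * l ∧ t s ≠ t (s + l) := by
  classical
  have h : 1 < (Finset.univ.erase x).card := by
    rw [Finset.card_erase_of_mem (Finset.mem_univ x), Finset.card_univ]
    omega
  obtain ⟨a, ha, b, hb, hab⟩ := Finset.one_lt_card.mp h
  refine ⟨fun n => if thueMorse n then a else b, fun i => ?_, fun l hl c => ?_⟩
  · dsimp only
    split_ifs
    · exact Finset.ne_of_mem_erase ha
    · exact Finset.ne_of_mem_erase hb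
  · obtain ⟨s, h1, h2, h3⟩ := exists_thueMorse_ne l hl c
    refine ⟨s, h1, h2, ?_⟩
    cases h4 : thueMorse s <;> cases h5 : thueMorse (s + l) <;> simp_all [hab.symm]

/-! ### Records -/

/-- Beyond a suitable `M ≥ K`, infinitely many members of an infinite set are weak records
of `f`, counted from `M`. -/
lemma exists_infinitely_many_records {X : ℕ → Prop} (hX : ∀ N, ∃ n, N ≤ n ∧ X n) (f : ℕ → ℕ)
    (K : ℕ) : ∃ M, K ≤ M ∧ ∀ N, ∃ n, N ≤ n ∧ X n ∧ ∀ n', M ≤ n' → n' ≤ n → X n' → f n' ≤ f n := by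
  classical
  by_cases hb : ∀ m N, ∃ n, N ≤ n ∧ X n ∧ m ≤ f n
  · refine ⟨K, le_rfl, fun N => ?_⟩
    obtain ⟨n₁, h1, h2, h3⟩ := hb ((Finset.range (N + 1)).sup f + 1) N
    obtain ⟨n, hn, hmax⟩ := Finset.exists_max_image ((Finset.range (n₁ + 1)).filter X) f
      ⟨n₁, by simp [h2]⟩
    simp only [Finset.mem_filter, Finset.mem_range] at hn hmax
    have h4 := hmax n₁ ⟨by omega, h2⟩
    refine ⟨n, ?_, hn.2, fun n' _ h h' => hmax n' ⟨by omega, h'⟩⟩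
    by_contra hc
    have := Finset.le_sup (f := f) (Finset.mem_range.mpr (show n < N + 1 by omega))
    omega
  · push Not at hb
    -- Bounded case: `m - 1` is the limsup of `f` along `X`, attained infinitely often and never
    -- exceeded from `N₀` on.
    obtain ⟨m, hm⟩ : ∃ m, (∃ N, ∀ n, N ≤ n → X n → f n < m) ∧
        ∀ m' < m, ¬ ∃ N, ∀ n, N ≤ n → X n → f n < m' :=
      ⟨Nat.find hb, Nat.find_spec hb, fun _ h => Nat.find_min hb h⟩
    obtain ⟨⟨N₀, hN₀⟩, hmin⟩ := hm
    refine ⟨max K N₀, le_max_left _ _, fun N => ?_⟩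
    have hm0 : 0 < m := by
      obtain ⟨n, h1, h2⟩ := hX N₀
      have := hN₀ n h1 h2
      omega
    have := hmin (m - 1) (by omega)
    push Not at this
    obtain ⟨n, h1, h2, h3⟩ := this N
    refine ⟨n, h1, h2, fun n' h4 _ h5 => ?_⟩
    have := hN₀ n' (by omega) h5
    omega

end PowerFreeWords

namespace PowerFreeWords

/-! ### Reflection, matches and splicing -/

/-- The reflection of a bi-infinite word about the origin. -/
def reflect {A : Type*} (v : ℤ → A) : ℤ → A := fun z => v (-z)

@[simp] lemma reflect_apply {A : Type*} (v : ℤ → A) (z : ℤ) : reflect v z = v (-z) := rfl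

lemma PeriodicOn.reflect {A : Type*} {u : ℤ → A} {a b l : ℤ} (h : PeriodicOn u a b l) :
    PeriodicOn (reflect u) (1 - b) (1 - a) l := by
  intro s h1 h2
  have := h (-(s + l)) (by omega) (by omega)
  rw [reflect_apply, reflect_apply, this]
  congr 1
  ring

lemma PeriodicOn.congr {A : Type*} {u v : ℤ → A} {a b l : ℤ} (h : PeriodicOn u a b l) (hl : 0 < l)
    (huv : ∀ z, a ≤ z → z < b → u z = v z) : PeriodicOn v a b l := by
  intro s h1 h2
  rw [← huv s h1 (by omega), ← huv (s + l) (by omega) h2, h s h1 h2]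

lemma PeriodicOn.mono {A : Type*} {u : ℤ → A} {a b a' b' l : ℤ} (h : PeriodicOn u a b l)
    (ha : a ≤ a') (hb : b' ≤ b) : PeriodicOn u a' b' l :=
  fun s h1 h2 => h s (by omega) (by omega)

/-- The length of the longest common prefix of `t` and the part of `v` to the right of `n`. -/
noncomputable def matchLen {A : Type*} (v : ℤ → A) (t : ℕ → A) (n : ℤ) : ℕ :=
  sInf {i : ℕ | v (n + 1 + i) ≠ t i}

lemma eq_of_lt_matchLen {A : Type*} {v : ℤ → A} {t : ℕ → A} {n : ℤ} {i : ℕ}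
    (h : i < matchLen v t n) : v (n + 1 + i) = t i := by
  simpa using Nat.notMem_of_lt_sInf h

/-- A mismatch is required because `sInf ∅ = 0`. -/
lemma le_matchLen {A : Type*} {v : ℤ → A} {t : ℕ → A} {n : ℤ} {m : ℕ}
    (hne : ∃ i : ℕ, v (n + 1 + i) ≠ t i) (h : ∀ i < m, v (n + 1 + i) = t i) :
    m ≤ matchLen v t n := by
  by_contra! hc
  exact Nat.sInf_mem (s := {i : ℕ | v (n + 1 + i) ≠ t i}) hne (h _ hc)

lemma exists_mismatch {A : Type*} {v : ℤ → A} {t : ℕ → A} {x : A} (ht : ∀ i, t i ≠ x)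
    (hv : ∀ N : ℕ, ∃ n, N ≤ n ∧ v n = x) (n : ℤ) : ∃ i : ℕ, v (n + 1 + i) ≠ t i := by
  obtain ⟨m, h1, h2⟩ := hv (n + 1).toNat
  refine ⟨(m - (n + 1)).toNat, ?_⟩
  rw [show n + 1 + (((m : ℤ) - (n + 1)).toNat : ℤ) = m by omega, h2]
  exact (ht _).symm

/-- A run through the last occurrence `n` of `x` extends beyond `n` by less than its period. -/
lemma PeriodicOn.le_add_period {A : Type*} {u : ℤ → A} {t : ℕ → A} {x : A} {n a b l : ℤ}
    (ht : ∀ i, t i ≠ x) (hn : u n = x) (hu : ∀ i : ℕ, u (n + 1 + i) = t i)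
    (h : PeriodicOn u a b l) (hl : 0 < l) (ha : a ≤ n) : b ≤ n + l := by
  by_contra! hc
  have h1 := h n ha hc
  have h2 := hu (l - 1).toNat
  rw [show n + 1 + ((l - 1).toNat : ℤ) = n + l by omega] at h2
  exact ht _ (by rw [← h2, ← h1, hn])

/-- `n` is an occurrence of `x` at which the match with `t` is at least as long as at all
occurrences of `x` between `M` and `n`. -/
def IsRecord {A : Type*} (v : ℤ → A) (t : ℕ → A) (x : A) (M n : ℕ) : Prop :=
  v n = x ∧ ∀ n' : ℕ, M ≤ n' → n' ≤ n → v n' = x → matchLen v t n' ≤ matchLen v t n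

lemma IsRecord.lt_of_periodicOn {A : Type*} {u v : ℤ → A} {t : ℕ → A} {x : A} {M n : ℕ}
    {a b l : ℤ} (hr : IsRecord v t x M n) (hne : ∀ n : ℤ, ∃ i : ℕ, v (n + 1 + i) ≠ t i)
    (hu : ∀ i : ℕ, u (n + 1 + i) = t i) (huv : ∀ z, (n : ℤ) - l ≤ z → z ≤ n → u z = v z)
    (h : PeriodicOn u a b l) (hl : 0 < l) (ha : a ≤ n - l)
    (hb : n + 1 + matchLen v t n < b) (hb' : b ≤ n + l) : (n : ℤ) - l < M := by
  by_contra! hc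
  have e : (((n : ℤ) - l).toNat : ℤ) = n - l := by omega
  have h1 := h (n - l) ha (by omega)
  rw [sub_add_cancel, huv _ le_rfl (by omega), huv _ (by omega) le_rfl, hr.1] at h1
  have h2 := hr.2 ((n : ℤ) - l).toNat (by omega) (by omega) (by rw [e, h1])
  -- The run covers the first mismatch after `n`, so translating by `-l` gains a letter of match.
  have h3 : matchLen v t n + 1 ≤ matchLen v t (((n : ℤ) - l).toNat : ℤ) := by
    refine le_matchLen (hne _) fun i hi => ?_
    rw [e, ← hu i, ← huv _ (by omega) (by omega), h _ (by omega) (by omega)]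
    congr 1
    ring
  omega

/-- The word obtained from `v` by writing `t` to the right of `n`. -/
def extendRight {A : Type*} (v : ℤ → A) (t : ℕ → A) (n : ℤ) : ℤ → A :=
  fun z => if z ≤ n then v z else t (z - n - 1).toNat

lemma extendRight_of_le {A : Type*} {v : ℤ → A} {t : ℕ → A} {n z : ℤ} (h : z ≤ n) :
    extendRight v t n z = v z := if_pos h

lemma extendRight_add {A : Type*} (v : ℤ → A) (t : ℕ → A) (n : ℤ) (i : ℕ) :
    extendRight v t n (n + 1 + i) = t i := by
  rw [extendRight, if_neg (by omega)]
  congr 1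
  omega

/-- The word obtained from `v` by writing `t` to the right of `n` and the reversal of `t` to the
left of `-q`. -/
def extendBoth {A : Type*} (v : ℤ → A) (t : ℕ → A) (n q : ℤ) : ℤ → A :=
  fun z => if z < -q then t (-q - 1 - z).toNat else extendRight v t n z

lemma extendBoth_mid {A : Type*} {v : ℤ → A} {t : ℕ → A} {n q z : ℤ} (h : -q ≤ z) (h' : z ≤ n) :
    extendBoth v t n q z = v z := by
  rw [extendBoth, if_neg (by omega), extendRight_of_le h']

lemma extendBoth_right {A : Type*} (v : ℤ → A) (t : ℕ → A) {n q : ℤ} (h : -q ≤ n) (i : ℕ) :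
    extendBoth v t n q (n + 1 + i) = t i := by
  rw [extendBoth, if_neg (by omega), extendRight_add]

lemma reflect_extendBoth {A : Type*} (v : ℤ → A) (t : ℕ → A) {n q : ℤ} (h : -q ≤ n) :
    reflect (extendBoth v t n q) = extendBoth (reflect v) t q n := by
  funext z
  simp only [reflect, extendBoth, extendRight]
  split_ifs <;> first | rfl | omega | (congr 2; omega)

lemma extendBoth_eq {A : Type*} {v : ℤ → A} {t : ℕ → A} {n q z : ℤ} (h : -q ≤ n)
    (h1 : -q - matchLen (reflect v) t q ≤ z) (h2 : z < n + 1 + matchLen v t n) :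
    extendBoth v t n q z = v z := by
  by_cases hz : z ≤ n
  · by_cases hz' : -q ≤ z
    · exact extendBoth_mid hz' hz
    · have hi : (-q - 1 - z).toNat < matchLen (reflect v) t q := by omega
      rw [extendBoth, if_pos (by omega), ← eq_of_lt_matchLen hi, reflect_apply]
      congr 1
      omega
  · obtain ⟨i, hi⟩ := Int.eq_ofNat_of_zero_le (show 0 ≤ z - (n + 1) by omega)
    obtain rfl : z = n + 1 + i := by omega
    have hi : i < matchLen v t n := by omega
    rw [extendBoth_right v t h, eq_of_lt_matchLen hi]

/-- `t` has no factor of period `l` and length `5 * l`. -/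
def FivePowerFree {A : Type*} (t : ℕ → A) : Prop :=
  ∀ l, 0 < l → ∀ a, ∃ s, a ≤ s ∧ s < a + 4 * l ∧ t s ≠ t (s + l)

lemma FivePowerFree.not_periodicOn {A : Type*} {t : ℕ → A} (ht : FivePowerFree t) {u : ℤ → A}
    {n a b l : ℤ} (hu : ∀ i : ℕ, u (n + 1 + i) = t i) (hl : 0 < l) (hab : 5 * l ≤ b - a)
    (ha : n < a) : ¬ PeriodicOn u a b l := by
  intro h
  obtain ⟨s, h1, h2, h3⟩ := ht l.toNat (by omega) (a - (n + 1)).toNat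
  refine h3 ?_
  rw [← hu, ← hu, h _ (by omega) (by omega)]
  congr 1
  push_cast
  omega

/-- An obstruction to cutting `v` at `n` on the right, given a cut at `-q` on the left. -/
def RightObstruction {A : Type*} (v : ℤ → A) (t : ℕ → A) (M n q : ℕ) (l : ℤ) : Prop :=
  0 < l ∧ (n : ℤ) - M < l ∧ PeriodicOn v (n - 4 * l) (n + 1) l ∧ -(q : ℤ) ≤ n - 3 * l ∧
    matchLen v t n < l

section extendBoth

variable {A : Type*} {v : ℤ → A} {t : ℕ → A} {x : A} {M M' n q : ℕ} {a b l : ℤ}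

lemma neg_sub_lt_of_periodicOn (ht : ∀ i, t i ≠ x) (hq : v (-q) = x)
    (h : PeriodicOn (extendBoth v t n q) a b l) (hl : 0 < l) (hb : -(q : ℤ) < b) :
    -(q : ℤ) - l < a := by
  have h' := h.reflect
  rw [reflect_extendBoth _ _ (by omega)] at h'
  have := h'.le_add_period (n := q) ht (by rw [extendBoth_mid (by omega) le_rfl, reflect_apply, hq])
    (extendBoth_right _ _ (by omega)) hl (by omega)
  omega

lemma IsRecord.rightObstruction (ht : ∀ i, t i ≠ x)
    (hne : ∀ n : ℤ, ∃ i : ℕ, v (n + 1 + i) ≠ t i) (hn : IsRecord v t x M n) (hq : v (-q) = x)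
    (h : PeriodicOn (extendBoth v t n q) a b l) (hl : 0 < l) (hab : 5 * l ≤ b - a)
    (ha : a ≤ n) (hb : n + 1 + matchLen v t n < b)
    (ha' : -(q : ℤ) - matchLen (reflect v) t q ≤ a) : RightObstruction v t M n q l := by
  have hbl : b ≤ n + l := h.le_add_period ht (by rw [extendBoth_mid (by omega) le_rfl, hn.1])
    (extendBoth_right _ _ (by omega)) hl ha
  have hal := neg_sub_lt_of_periodicOn ht hq h hl (by omega)
  refine ⟨hl, ?_, ?_, by omega, by omega⟩
  · have := hn.lt_of_periodicOn hne (extendBoth_right _ _ (by omega))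
      (fun z h1 h2 => extendBoth_mid (by omega) h2) h hl (by omega) hb hbl
    omega
  · exact (h.mono (a' := n - 4 * l) (b' := n + 1) (by omega) (by omega)).congr hl
      fun z h1 h2 => extendBoth_eq (by omega) (by omega) (by omega)

lemma exists_obstruction (htx : ∀ i, t i ≠ x) (ht : FivePowerFree t)
    (hne : ∀ n : ℤ, ∃ i : ℕ, v (n + 1 + i) ≠ t i)
    (hne' : ∀ n : ℤ, ∃ i : ℕ, reflect v (n + 1 + i) ≠ t i)
    (hn : IsRecord v t x M n) (hq : IsRecord (reflect v) t x M' q)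
    (hnq : 3 * (M + M') ≤ n + q)
    (h : PeriodicOn (extendBoth v t n q) a b l) (hl : 0 < l) (hab : 5 * l ≤ b - a)
    (hv : ¬ PeriodicOn v a b l) :
    RightObstruction v t M n q l ∨ RightObstruction (reflect v) t M' q n l := by
  have h' := h.reflect
  rw [reflect_extendBoth _ _ (by omega)] at h'
  have ha : a ≤ n := by
    by_contra! hc
    exact ht.not_periodicOn (extendBoth_right v t (by omega)) hl hab hc h
  have hb : 1 - b ≤ q := by
    by_contra! hc
    exact ht.not_periodicOn (extendBoth_right (reflect v) t (by omega)) hl (by omega) hc h'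
  have hn1 : reflect v (-(n : ℤ)) = x := by rw [reflect_apply, neg_neg, hn.1]
  have hq1 : v (-(q : ℤ)) = x := hq.1
  by_cases hr : n + 1 + matchLen v t n < b
  · by_cases hs : -(q : ℤ) - matchLen (reflect v) t q ≤ a
    · exact Or.inl (hn.rightObstruction htx hne hq1 h hl hab ha hr hs)
    -- Outlasting both matches gives `l > n - M`, `l > q - M'` and `3 * l < n + q`, against `hnq`.
    · exfalso
      have h1 : -(q : ℤ) - l < a := neg_sub_lt_of_periodicOn htx hq1 h hl (by omega)
      have h2 : -(n : ℤ) - l < 1 - b := neg_sub_lt_of_periodicOn htx hn1 h' hl (by omega)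
      have h3 := hn.lt_of_periodicOn hne (extendBoth_right _ _ (by omega))
        (fun z h1 h2 => extendBoth_mid (by omega) h2) h hl (by omega) hr (by omega)
      have h4 := hq.lt_of_periodicOn hne' (extendBoth_right _ _ (by omega))
        (fun z h1 h2 => extendBoth_mid (by omega) h2) h' hl (by omega) (by omega) (by omega)
      omega
  · by_cases hs : -(q : ℤ) - matchLen (reflect v) t q ≤ a
    · exact (hv (h.congr hl fun z h1 h2 => extendBoth_eq (by omega) (by omega) (by omega))).elim
    · exact Or.inr (hq.rightObstruction htx hne' hn1 h' hl (by omega) hb (by omega)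
        (by
          have : reflect (reflect v) = v := funext fun z => by simp
          rw [this]; omega))

end extendBoth

/-- Periodicity carries the `x` at `q` and its match to `q + l`; the best occurrence in `(q, q + l]`
is then a record. -/
lemma IsRecord.exists_shift {A : Type*} {v : ℤ → A} {t : ℕ → A} {x : A} {M q : ℕ} {l a b : ℤ}
    (hne : ∀ n : ℤ, ∃ i : ℕ, v (n + 1 + i) ≠ t i) (hq : IsRecord v t x M q) (hl : 0 < l)
    (h : PeriodicOn v a b l) (ha : a ≤ q) (hb : q + l + matchLen v t q < b) :
    ∃ r : ℕ, q < r ∧ (r : ℤ) ≤ q + l ∧ IsRecord v t x M r := by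
  classical
  obtain ⟨m, rfl⟩ := Int.eq_ofNat_of_zero_le hl.le
  have hx : v ((q + m : ℕ) : ℤ) = x := by
    rw [Nat.cast_add, ← h _ ha (by omega), hq.1]
  have hf : matchLen v t q ≤ matchLen v t ((q + m : ℕ) : ℤ) := by
    refine le_matchLen (hne _) fun i hi => ?_
    rw [← eq_of_lt_matchLen hi, h (q + 1 + i) (by omega) (by omega)]
    congr 1
    push_cast
    ring
  obtain ⟨r, hr, hmax⟩ := Finset.exists_max_image
    ((Finset.Ioc q (q + m)).filter fun r : ℕ => v r = x) (fun r : ℕ => matchLen v t r)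
    ⟨q + m, by simp only [Finset.mem_filter, Finset.mem_Ioc]; exact ⟨⟨by omega, le_rfl⟩, hx⟩⟩
  simp only [Finset.mem_filter, Finset.mem_Ioc] at hr hmax
  refine ⟨r, hr.1.1, by omega, hr.2, fun n' h1 h2 h3 => ?_⟩
  by_cases hc : q < n'
  · exact hmax n' ⟨⟨hc, by omega⟩, h3⟩
  · exact (hq.2 n' h1 (by omega) h3).trans (hf.trans (hmax (q + m) ⟨⟨by omega, le_rfl⟩, hx⟩))

/-! ### Choosing the cuts -/

lemma exists_unobstructed {A : Type*} {v : ℤ → A} {t : ℕ → A} {x : A} {M M' K : ℕ}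
    (hne' : ∀ n : ℤ, ∃ i : ℕ, reflect v (n + 1 + i) ≠ t i)
    (hP : ∀ N, ∃ n, N ≤ n ∧ IsRecord v t x M n)
    (hQ : ∀ N, ∃ q, N ≤ q ∧ IsRecord (reflect v) t x M' q) :
    ∃ n q : ℕ, K ≤ n ∧ K ≤ q ∧ IsRecord v t x M n ∧ IsRecord (reflect v) t x M' q ∧
      (∀ l, ¬ RightObstruction v t M n q l) ∧ ∀ l, ¬ RightObstruction (reflect v) t M' q n l := by
  classical
  obtain ⟨q₀, hq₀, hq₀r⟩ := hQ K
  obtain ⟨n, hn, hnr⟩ := hP (q₀ + K + 10 * (M + M') + 10)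
  by_cases hD : ∃ l : ℕ, 0 < l ∧ (n : ℤ) - M < l ∧ PeriodicOn v (n - 4 * l) (n + 1) l
  · obtain ⟨l, ⟨hl, hlM, hper⟩, hmin⟩ : ∃ l : ℕ, (0 < l ∧ (n : ℤ) - M < l ∧
        PeriodicOn v (n - 4 * l) (n + 1) l) ∧ ∀ m < l, ¬ (0 < m ∧ (n : ℤ) - M < m ∧
        PeriodicOn v (n - 4 * m) (n + 1) m) :=
      ⟨Nat.find hD, Nat.find_spec hD, fun _ h => Nat.find_min hD h⟩
    -- With `l` minimal, `q < 3 * l - n` rules out every right obstruction, whose period would be at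
    -- least `l`.
    obtain ⟨q, hq, hmax⟩ := Finset.exists_max_image
      ((Finset.Ico K (3 * l - n)).filter fun q => IsRecord (reflect v) t x M' q) id
      ⟨q₀, by simp only [Finset.mem_filter, Finset.mem_Ico]; exact ⟨⟨hq₀, by omega⟩, hq₀r⟩⟩
    simp only [Finset.mem_filter, Finset.mem_Ico, id] at hq hmax
    refine ⟨n, q, by omega, hq.1.1, hnr, hq.2, ?_, ?_⟩
    · rintro m ⟨h1, h2, h3, h4, -⟩
      obtain ⟨m, rfl⟩ := Int.eq_ofNat_of_zero_le h1.le
      have := hmin m (by omega)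
      exact this ⟨by omega, h2, h3⟩
    -- Here `3 * m ≤ n + q < 3 * l` and `q - M' < m`, so `2 * q < n + 3 * M'`. The run of period `l`
    -- then yields a record above `q`, still below `3 * l - n`, against maximality.
    · rintro m ⟨h1, h2, -, h4, h5⟩
      obtain ⟨r, hr1, hr2, hr⟩ := hq.2.exists_shift hne' (l := l) (by omega) hper.reflect
        (by omega) (by omega)
      have := hmax r ⟨⟨by omega, by omega⟩, hr⟩
      omega
  · obtain ⟨q, hq, hqr⟩ := hQ (n + K + 3 * M')
    refine ⟨n, q, by omega, by omega, hnr, hqr, ?_, ?_⟩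
    · rintro l ⟨h1, h2, h3, -⟩
      obtain ⟨m, rfl⟩ := Int.eq_ofNat_of_zero_le h1.le
      exact hD ⟨m, by omega, h2, h3⟩
    · rintro l ⟨h1, h2, -, h4, -⟩
      omega

lemma RunFree.extendRight {A : Type*} {α : ℚ} (hα : 5 ≤ α) {v : ℤ → A} (hv : RunFree α v)
    {t : ℕ → A} {x : A} {M n K : ℕ} (htx : ∀ i, t i ≠ x) (ht : FivePowerFree t)
    (hne : ∀ n : ℤ, ∃ i : ℕ, v (n + 1 + i) ≠ t i) (hn : IsRecord v t x M n)
    (hK : ∀ z : ℤ, z < -K → v z ≠ x) (hnK : K + 2 * M ≤ n) :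
    RunFree α (extendRight v t n) := by
  intro a b l hl hab h
  have hab5 : 5 * l ≤ b - a := by
    have hl' : (0 : ℚ) < l := by exact_mod_cast hl
    have : (5 * l : ℚ) ≤ ((b - a : ℤ) : ℚ) := le_trans (by gcongr) hab
    exact_mod_cast this
  have ha : a ≤ n := by
    by_contra! hc
    exact ht.not_periodicOn (extendRight_add v t n) hl hab5 hc h
  by_cases hb : n + 1 + matchLen v t n < b
  · have hbl : b ≤ n + l := h.le_add_period htx (by rw [extendRight_of_le le_rfl, hn.1])
      (extendRight_add v t n) hl ha
    have h1 := hn.lt_of_periodicOn hne (extendRight_add v t n)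
      (fun z _ h2 => extendRight_of_le h2) h hl (by omega) hb hbl
    -- Two steps back from `n` lands below `-K`, since `l > n - M` and `n ≥ K + 2 * M`.
    have h2 := h (n - l) (by omega) (by omega)
    have h3 := h (n - l - l) (by omega) (by omega)
    rw [sub_add_cancel] at h2 h3
    rw [h2, extendRight_of_le (by omega), extendRight_of_le le_rfl, hn.1] at h3
    exact hK _ (by omega) h3
  · refine hv a b l hl hab (h.congr hl fun z h1 h2 => ?_)
    by_cases hz : z ≤ n
    · exact extendRight_of_le hz
    · obtain ⟨i, hi⟩ := Int.eq_ofNat_of_zero_le (show 0 ≤ z - (n + 1) by omega)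
      obtain rfl : z = n + 1 + i := by omega
      have hi : i < matchLen v t n := by omega
      rw [extendRight_add, eq_of_lt_matchLen hi]

theorem RunFree.exists_finitely_many_occurrences {A : Type*} [Fintype A]
    (hA : 3 ≤ Fintype.card A) {α : ℚ} (hα : 5 ≤ α) {v : ℤ → A} (hv : RunFree α v) {x : A}
    (hx : ∀ N : ℕ, ∃ n, N ≤ n ∧ v n = x) (K : ℕ) :
    ∃ v' : ℤ → A, RunFree α v' ∧ (∀ z : ℤ, -K ≤ z → z ≤ K → v' z = v z) ∧
      ∃ p q : ℤ, ∀ z, v' z = x → p ≤ z ∧ z ≤ q := by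
  obtain ⟨t, htx, ht⟩ := exists_word_avoiding hA x
  have hne := exists_mismatch htx hx
  obtain ⟨M, -, hM⟩ := exists_infinitely_many_records (X := fun n => v n = x) hx
    (fun n => matchLen v t n) 0
  by_cases hx' : ∀ N : ℕ, ∃ n, N ≤ n ∧ reflect v n = x
  · have hne' := exists_mismatch htx hx'
    obtain ⟨M', -, hM'⟩ := exists_infinitely_many_records (X := fun n => reflect v n = x) hx'
      (fun n => matchLen (reflect v) t n) 0
    obtain ⟨n, q, hKn, hKq, hn, hq, h1, h2⟩ := exists_unobstructed (v := v) (t := t) (x := x)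
      (M := M) (M' := M') (K := K + 3 * (M + M')) hne' hM hM'
    refine ⟨extendBoth v t n q, ?_, fun z h3 h4 => extendBoth_mid (by omega) (by omega),
      -q, n, fun z hz => ?_⟩
    · intro a b l hl hab h
      have hab5 : 5 * l ≤ b - a := by
        have hl' : (0 : ℚ) < l := by exact_mod_cast hl
        have : (5 * l : ℚ) ≤ ((b - a : ℤ) : ℚ) := le_trans (by gcongr) hab
        exact_mod_cast this
      rcases exists_obstruction htx ht hne hne' hn hq (by omega) h hl hab5 (hv a b l hl hab)
        with h3 | h3
      · exact h1 _ h3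
      · exact h2 _ h3
    · by_contra hc
      unfold extendBoth PowerFreeWords.extendRight at hz
      split_ifs at hz
      · exact htx _ hz
      · omega
      · exact htx _ hz
  · push Not at hx'
    obtain ⟨K', hK'⟩ := hx'
    obtain ⟨n, hKn, hn⟩ := hM (K + K' + 2 * M)
    have hleft : ∀ z : ℤ, z < -K' → v z ≠ x := fun z hz => by
      have := hK' (-z).toNat (by omega)
      rwa [reflect_apply, show -((-z).toNat : ℤ) = z by omega] at this
    refine ⟨_, hv.extendRight hα htx ht hne hn hleft (by omega),
      fun z h3 h4 => extendRight_of_le (by omega), -K', n, fun z hz => ?_⟩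
    unfold PowerFreeWords.extendRight at hz
    split_ifs at hz with h
    · exact ⟨by by_contra hc; exact hleft z (by omega) hz, h⟩
    · exact (htx _ hz).elim

end PowerFreeWords

open PowerFreeWords in
lemma PowerFreeWords.BiWord.occursAt_singleton {A : Type*} {v : BiWord A} {x : A} {i : ℤ} :
    BiWord.OccursAt v [x] i ↔ v i = x := by
  simp [BiWord.OccursAt, eq_comm]

theorem mainTheorem3 {A : Type*} [Fintype A] (k : ℕ) (hA : Fintype.card A = k) (hk : 3 ≤ k)
    (α : ℚ) (hα : 5 ≤ α)
    (v : PowerFreeWords.BiWord A) (hv : PowerFreeWords.BiWord.PowerFree α v)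
    (w : List A) (hw : PowerFreeWords.BiWord.IsFactor v w) (hw0 : w ≠ [])
    (x : A) (hx : x ∈ w)
    (hrec : PowerFreeWords.BiWord.IsOnRightSideRecurrent α v [x]) :
    ∃ v' : PowerFreeWords.BiWord A, PowerFreeWords.BiWord.PowerFree α v' ∧
      PowerFreeWords.BiWord.IsFactor v' w ∧ ¬ PowerFreeWords.BiWord.IsRecurrent v' [x] := by
  obtain ⟨v₁, v₂, -, -, ⟨c, hc, -⟩, -, hinf⟩ := hrec
  have hright : ∀ N : ℕ, ∃ n, N ≤ n ∧ v n = x := fun N => by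
    obtain ⟨i, hi, hi'⟩ := hinf.exists_gt (N + c.natAbs)
    have hix : v₂ i = x := by
      simpa [PowerFreeWords.RightWord.OccursAt, eq_comm] using hi
    refine ⟨(c + i).toNat, by omega, ?_⟩
    rw [show ((c + i).toNat : ℤ) = c + i by omega, hc, hix]
  obtain ⟨i, hi⟩ := hw
  obtain ⟨v', h1, h2, p, q, h3⟩ := (hv.runFree (by linarith)).exists_finitely_many_occurrences
    (hA ▸ hk) hα hright (i.natAbs + w.length)
  refine ⟨v', h1.biWord_powerFree, ⟨i, ?_⟩, fun h => h.2 ?_⟩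
  · rw [PowerFreeWords.BiWord.OccursAt] at hi ⊢
    conv_lhs => rw [hi]
    refine List.map_congr_left fun j hj => ?_
    have := List.mem_range.mp hj
    exact (h2 _ (by omega) (by omega)).symm
  · exact (Set.finite_Icc p q).subset fun z hz =>
      h3 z (PowerFreeWords.BiWord.occursAt_singleton.mp hz)
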